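/- Let $K$ be a field of characteristic zero, $K'$ a subfield of $K$, $R'=K'[x_1,\dots,x_n]$ and $R=K[x_1,\dots,x_n]$ with $\deg x_i=1$. An ideal $I$ of a polynomial ring is called Artinian graded if it is homogeneous and its quotient ring is Artinian. For such an ideal, let $A=\bigoplus_{i\ge 0}A_i$ be the graded quotient algebra. A linear form $z\in A_1$ is a *strong Lefschetz (SL) element* of $A$ if for all $d,i\ge 0$ the multiplication map $\times z^d:A_i\to A_{i+d}$ has full rank (is injective or surjective); $A$ has the *strong Lefschetz property* (SLP) if it has an SL element. In particular the zero algebra has the SLP. Let $J$ be an Artinian graded ideal of $R'$ such that $R'/J$ has the SLP. (1) If $\eta_1,\dots,\eta_n\in K$ are algebraically independent over $K'$, then $JR$ is an Artinian graded ideal of $R$, and the image of $\eta_1x_1+\cdots+\eta_nx_n$ in $R/JR$ is an SL element of $R/JR$. (2) Let $m\ge 0$ and let the family $(\xi_{ij})_{1\le i\le m,\,1\le j\le n}$ of elements of $K$ be algebraically independent over $K'$. Put $L_i=\xi_{i1}x_1+\cdots+\xi_{in}x_n\in R$ for $1\le i\le m$. Then for all positive integers $d_1,\dots,d_m$ the ideal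 $JR:L_1^{d_1}L_2^{d_2}\cdots L_m^{d_m}$ of $R$ is Artinian graded, and $R/(JR:L_1^{d_1}L_2^{d_2}\cdots L_m^{d_m})$ has the SLP. -/

import Mathlib

noncomputable section

attribute [local instance] MvPolynomial.gradedAlgebra

/-- The degree `i` part of the standard graded algebra `K[x₁, …, xₙ] / I` (`I` a graded ideal):
the image of the forms of degree `i`. -/
def quotientGrading {K : Type*} [Field K] {n : ℕ} (I : Ideal (MvPolynomial (Fin n) K)) (i : ℕ) :
    Submodule K (MvPolynomial (Fin n) K ⧸ I) :=
  (MvPolynomial.homogeneousSubmodule (Fin n) K i).map (Ideal.Quotient.mkₐ K I).toLinearMap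

/-- `I` is an Artinian graded ideal of the polynomial ring: it is homogeneous for the standard
grading, and its quotient ring is Artinian. -/
def IsArtinianGraded {K : Type*} [Field K] {n : ℕ} (I : Ideal (MvPolynomial (Fin n) K)) : Prop :=
  I.IsHomogeneous (MvPolynomial.homogeneousSubmodule (Fin n) K) ∧
    IsArtinianRing (MvPolynomial (Fin n) K ⧸ I)

/-- `z` is a strong Lefschetz element of `A = ⨁ 𝒜 i`: a linear form such that every map
`× z ^ d : 𝒜 i → 𝒜 (i + d)` has full rank, that is, is injective or surjective.
If `c` is the largest degree with `𝒜 c ≠ 0`, the condition is automatic for `d = 0` (the identity)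
and for `i + d > c` (the target is zero), so only `1 ≤ d ≤ c` and `0 ≤ i ≤ c - d` matter. -/
def IsSLElement {K A : Type*} [Field K] [CommRing A] [Algebra K A] (𝒜 : ℕ → Submodule K A)
    (z : A) : Prop :=
  z ∈ 𝒜 1 ∧ ∀ d i : ℕ,
    Set.InjOn (fun a : A => z ^ d * a) (𝒜 i) ∨
      Set.SurjOn (fun a : A => z ^ d * a) (𝒜 i) (𝒜 (i + d))

/-- The strong Lefschetz property of `K[x₁, …, xₙ] / I`. -/
def HasSLP {K : Type*} [Field K] {n : ℕ} (I : Ideal (MvPolynomial (Fin n) K)) : Prop :=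
  ∃ z : MvPolynomial (Fin n) K ⧸ I, IsSLElement (quotientGrading I) z

/-- The linear form `a₁ x₁ + ⋯ + aₙ xₙ`. -/
def linearForm {K : Type*} [Field K] {n : ℕ} (a : Fin n → K) : MvPolynomial (Fin n) K :=
  ∑ j, MvPolynomial.C (a j) * MvPolynomial.X j

/-- The extension `J R` of an ideal `J` of `K'[x₁, …, xₙ]` to `R = K[x₁, …, xₙ]`. -/
def extendIdeal {K' : Type*} (K : Type*) [Field K'] [Field K] [Algebra K' K] {n : ℕ}
    (J : Ideal (MvPolynomial (Fin n) K')) : Ideal (MvPolynomial (Fin n) K) :=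
  J.map (MvPolynomial.map (algebraMap K' K))

end

/-!
Write `R = K[x₁, …, xₙ]` and `ψ : R'/J → R/JR` for the base change map. Everything rests on two
facts about the extension of scalars.

* A `K'`-linear map `φ : K → K'` applied coefficientwise is an `R'`-linear map `R → R'`, and `f ∈ JR`
  if and only if all these maps send `f` into `J` (`mem_extendIdeal_iff`). Hence extension of ideals
  preserves homogeneity and commutes with colons by elements of `R'` (`extendIdeal_colon`).
* Every `K'`-linear functional on `R'/J` extends along `ψ` to a `K`-linear functional on `R/JR`
  (`exists_functional_extendIdeal`), and the pieces of `R/JR` are spanned by the images of those of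
  `R'/J` (`quotientGrading_extendIdeal_le`).

For part (1), let `c₁ x₁ + ⋯ + cₙ xₙ` be an SL element of `R'/J`. If its `d`-th power is injective
or surjective on a graded piece, some square matrix of values of functionals becomes the identity.
The entries of that matrix are polynomials over `K'` in the coefficients of the linear form, so its
determinant is a polynomial that does not vanish at `c`; hence it does not vanish at algebraically
independent `η`, and the power of `η₁ x₁ + ⋯ + ηₙ xₙ` is again injective or surjective
(`IsSLElement.of_specialization`).

For part (2), `R/(I : L ^ e)` is, up to a shift, the ideal `L ^ e · R/I`, so an SL element `L` of
`R/I` stays an SL element of `R/(I : L ^ e)` (`IsSLElement.colon_pow`). Now peel off one linear form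
at a time: over `E = K'(ξ₁₁, …, ξ₁ₙ)` the form `L₁` is an SL element of `E[x]/J E[x]` by part (1),
hence `J E[x] : L₁ ^ d₁` has the SLP over `E`, and the remaining `ξᵢⱼ` are algebraically independent
over `E` (`colon_prod_linearForm`).
-/

noncomputable section

attribute [local instance] MvPolynomial.gradedAlgebra

open MvPolynomial

/-! ### Extension of scalars -/

section BaseChange

variable {K' K : Type*} [Field K'] [Field K] [Algebra K' K] {n : ℕ}

/-- The map `K[x₁, …, xₙ] → K'[x₁, …, xₙ]` that applies a `K'`-linear map `φ : K → K'` to each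
coefficient. -/
def coeffwise (φ : K →ₗ[K'] K') : MvPolynomial (Fin n) K →ₗ[K'] MvPolynomial (Fin n) K' :=
  (basisMonomials (Fin n) K').repr.symm.toLinearMap ∘ₗ Finsupp.mapRange.linearMap φ ∘ₗ
    (basisMonomials (Fin n) K).repr.toLinearMap.restrictScalars K'

lemma coeff_coeffwise (φ : K →ₗ[K'] K') (f : MvPolynomial (Fin n) K) (m : Fin n →₀ ℕ) :
    coeff m (coeffwise φ f) = φ (coeff m f) := by
  rfl

/-- `coeffwise φ` is linear over `K'[x₁, …, xₙ]`. -/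
lemma coeffwise_mul_map (φ : K →ₗ[K'] K') (f : MvPolynomial (Fin n) K)
    (g : MvPolynomial (Fin n) K') :
    coeffwise φ (f * map (algebraMap K' K) g) = coeffwise φ f * g := by
  ext m
  rw [coeff_coeffwise, coeff_mul, coeff_mul, map_sum]
  refine Finset.sum_congr rfl fun p _ => ?_
  rw [coeff_map, coeff_coeffwise, mul_comm, ← Algebra.smul_def, map_smul, smul_eq_mul, mul_comm]

lemma homogeneousComponent_coeffwise (φ : K →ₗ[K'] K') (f : MvPolynomial (Fin n) K) (i : ℕ) :
    homogeneousComponent i (coeffwise φ f) = coeffwise φ (homogeneousComponent i f) := by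
  ext m
  rw [coeff_coeffwise, coeff_homogeneousComponent, coeff_homogeneousComponent, coeff_coeffwise]
  split_ifs <;> simp

lemma exists_sum_mul_map_of_mem_extendIdeal {J : Ideal (MvPolynomial (Fin n) K')}
    {f : MvPolynomial (Fin n) K} (hf : f ∈ extendIdeal K J) :
    ∃ (r : ℕ) (a : Fin r → MvPolynomial (Fin n) K) (g : Fin r → MvPolynomial (Fin n) K'),
      (∀ k, g k ∈ J) ∧ f = ∑ k, a k * map (algebraMap K' K) (g k) := by
  obtain ⟨r, a, g, h⟩ := Submodule.mem_span_set'.1 hf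
  choose g' hg' hgg' using fun k => (g k).2
  exact ⟨r, a, g', hg', by simp only [← h, smul_eq_mul, hgg']⟩

/-- Membership in `J R` can be tested by the coefficientwise maps. For the converse, expand the
coefficients of `f` in a `K'`-basis of `K`: the components of `f` are its images under the
coordinate functions. -/
lemma mem_extendIdeal_iff {J : Ideal (MvPolynomial (Fin n) K')} {f : MvPolynomial (Fin n) K} :
    f ∈ extendIdeal K J ↔ ∀ φ : K →ₗ[K'] K', coeffwise φ f ∈ J := by
  constructor
  · intro hf φ
    obtain ⟨r, a, g, hg, rfl⟩ := exists_sum_mul_map_of_mem_extendIdeal hf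
    rw [map_sum]
    refine Ideal.sum_mem _ fun k _ => ?_
    rw [coeffwise_mul_map]
    exact Ideal.mul_mem_left _ _ (hg k)
  · intro h
    classical
    let b := Module.Basis.ofVectorSpace K' K
    let s := f.support.biUnion fun m => (b.repr (coeff m f)).support
    have hf : f = ∑ k ∈ s, C (b k) * map (algebraMap K' K) (coeffwise (b.coord k) f) := by
      ext m
      simp only [coeff_sum, coeff_C_mul, coeff_map, coeff_coeffwise]
      by_cases hm : coeff m f = 0
      · simp [hm]
      · conv_lhs => rw [← b.linearCombination_repr (coeff m f)]
        rw [Finsupp.linearCombination_apply, Finsupp.sum_of_support_subset (s := s)]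
        · refine Finset.sum_congr rfl fun k _ => ?_
          rw [Algebra.smul_def, mul_comm]
          rfl
        · exact Finset.subset_biUnion_of_mem (fun m => (b.repr (coeff m f)).support)
            (mem_support_iff.2 hm)
        · simp
    rw [hf]
    exact Ideal.sum_mem _ fun k _ => Ideal.mul_mem_left _ _ (Ideal.mem_map_of_mem _ (h _))

/-- Colon ideals by an element of the small polynomial ring commute with extension of scalars (an
instance of flatness). -/
lemma extendIdeal_colon (J : Ideal (MvPolynomial (Fin n) K')) (F : MvPolynomial (Fin n) K') :
    extendIdeal K (J.colon {F}) = (extendIdeal K J).colon {map (algebraMap K' K) F} := by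
  ext f
  simp only [mem_extendIdeal_iff, Submodule.mem_colon_singleton, smul_eq_mul, coeffwise_mul_map]

lemma extendIdeal_extendIdeal {E : Type*} [Field E] [Algebra K' E] [Algebra E K]
    [IsScalarTower K' E K] (J : Ideal (MvPolynomial (Fin n) K')) :
    extendIdeal K (extendIdeal E J) = extendIdeal K J := by
  rw [extendIdeal, extendIdeal, extendIdeal, Ideal.map_map]
  congr 1
  exact RingHom.ext fun p => by
    rw [RingHom.comp_apply, map_map, ← IsScalarTower.algebraMap_eq]

lemma map_linearForm (c : Fin n → K') :
    map (algebraMap K' K) (linearForm c) = linearForm fun j => algebraMap K' K (c j) := by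
  simp [linearForm]

lemma isHomogeneous_linearForm (c : Fin n → K) : (linearForm c).IsHomogeneous 1 :=
  IsHomogeneous.sum _ _ _ fun _ _ => isHomogeneous_C_mul_X _ _

lemma exists_eq_linearForm {f : MvPolynomial (Fin n) K} (hf : f.IsHomogeneous 1) :
    ∃ c, f = linearForm c := by
  have h : f ∈ homogeneousSubmodule (Fin n) K 1 := hf
  rw [homogeneousSubmodule_one_eq_span_X, Submodule.mem_span_range_iff_exists_fun] at h
  obtain ⟨c, rfl⟩ := h
  exact ⟨c, by simp [linearForm, smul_eq_C_mul]⟩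

lemma mem_quotientGrading_iff {I : Ideal (MvPolynomial (Fin n) K)} {i : ℕ}
    {a : MvPolynomial (Fin n) K ⧸ I} :
    a ∈ quotientGrading I i ↔ ∃ f, f.IsHomogeneous i ∧ Ideal.Quotient.mk I f = a :=
  Iff.rfl

lemma mk_mem_quotientGrading {I : Ideal (MvPolynomial (Fin n) K)} {i : ℕ}
    {f : MvPolynomial (Fin n) K} (hf : f.IsHomogeneous i) :
    Ideal.Quotient.mk I f ∈ quotientGrading I i :=
  mem_quotientGrading_iff.2 ⟨f, hf, rfl⟩

lemma isHomogeneous_of_homogeneousComponent_mem {I : Ideal (MvPolynomial (Fin n) K)}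
    (h : ∀ i, ∀ f ∈ I, homogeneousComponent i f ∈ I) :
    I.IsHomogeneous (homogeneousSubmodule (Fin n) K) := by
  intro i f hf
  have := h i f hf
  rwa [← decomposition.decompose'_apply] at this

lemma homogeneousComponent_mem_of_mem {I : Ideal (MvPolynomial (Fin n) K)}
    (h : I.IsHomogeneous (homogeneousSubmodule (Fin n) K)) (i : ℕ) {f} (hf : f ∈ I) :
    homogeneousComponent i f ∈ I := by
  have := h i hf
  rwa [← decomposition.decompose'_apply]

lemma isHomogeneous_colon {I : Ideal (MvPolynomial (Fin n) K)}
    (h : I.IsHomogeneous (homogeneousSubmodule (Fin n) K)) {F : MvPolynomial (Fin n) K} {e : ℕ}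
    (hF : F.IsHomogeneous e) :
    (I.colon {F}).IsHomogeneous (homogeneousSubmodule (Fin n) K) := by
  intro i f hf
  rw [Submodule.mem_colon_singleton, smul_eq_mul] at hf ⊢
  have := h (i + e) hf
  rwa [DirectSum.coe_decompose_mul_add_of_right_mem _ hF] at this

lemma isHomogeneous_extendIdeal {J : Ideal (MvPolynomial (Fin n) K')}
    (h : J.IsHomogeneous (homogeneousSubmodule (Fin n) K')) :
    (extendIdeal K J).IsHomogeneous (homogeneousSubmodule (Fin n) K) := by
  refine isHomogeneous_of_homogeneousComponent_mem fun i f hf => ?_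
  rw [mem_extendIdeal_iff] at hf ⊢
  intro φ
  rw [← homogeneousComponent_coeffwise]
  exact homogeneousComponent_mem_of_mem h i (hf φ)

lemma IsArtinianGraded.moduleFinite {J : Ideal (MvPolynomial (Fin n) K)}
    (h : IsArtinianGraded J) : Module.Finite K (MvPolynomial (Fin n) K ⧸ J) :=
  have := h.2
  Module.finite_of_isArtinianRing _ _

lemma IsArtinianGraded.colon {I : Ideal (MvPolynomial (Fin n) K)} (h : IsArtinianGraded I)
    {F : MvPolynomial (Fin n) K} {e : ℕ} (hF : F.IsHomogeneous e) :
    IsArtinianGraded (I.colon {F}) :=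
  have := h.2
  ⟨isHomogeneous_colon h.1 hF,
    (Ideal.Quotient.factor_surjective (Ideal.le_colon (I := I) (S := {F}))).isArtinianRing⟩

variable (K) in
/-- The ring homomorphism `K'[x₁, …, xₙ] / J → K[x₁, …, xₙ] / J R` induced by `K' → K`. -/
def quotientBaseChange (J : Ideal (MvPolynomial (Fin n) K')) :
    (MvPolynomial (Fin n) K' ⧸ J) →+* (MvPolynomial (Fin n) K ⧸ extendIdeal K J) :=
  Ideal.quotientMap _ (map (algebraMap K' K)) Ideal.le_comap_map

lemma quotientBaseChange_mk (J : Ideal (MvPolynomial (Fin n) K')) (f : MvPolynomial (Fin n) K') :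
    quotientBaseChange K J (Ideal.Quotient.mk J f) =
      Ideal.Quotient.mk _ (map (algebraMap K' K) f) :=
  rfl

lemma quotientBaseChange_smul (J : Ideal (MvPolynomial (Fin n) K')) (c : K')
    (a : MvPolynomial (Fin n) K' ⧸ J) :
    quotientBaseChange K J (c • a) = algebraMap K' K c • quotientBaseChange K J a := by
  obtain ⟨f, rfl⟩ := Ideal.Quotient.mk_surjective a
  rw [← Ideal.Quotient.mkₐ_eq_mk K', ← map_smul, Ideal.Quotient.mkₐ_eq_mk, quotientBaseChange_mk,
    quotientBaseChange_mk, ← Ideal.Quotient.mkₐ_eq_mk K, ← map_smul, smul_eq_C_mul, smul_eq_C_mul,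
    _root_.map_mul, map_C]

lemma quotientBaseChange_mem_quotientGrading {J : Ideal (MvPolynomial (Fin n) K')} {i : ℕ}
    {a : MvPolynomial (Fin n) K' ⧸ J} (ha : a ∈ quotientGrading J i) :
    quotientBaseChange K J a ∈ quotientGrading (extendIdeal K J) i := by
  obtain ⟨f, hf, rfl⟩ := mem_quotientGrading_iff.1 ha
  exact mk_mem_quotientGrading (hf.map _)

lemma quotientBaseChange_mem_span {J : Ideal (MvPolynomial (Fin n) K')}
    {S : Set (MvPolynomial (Fin n) K' ⧸ J)} {a : MvPolynomial (Fin n) K' ⧸ J}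
    (ha : a ∈ Submodule.span K' S) :
    quotientBaseChange K J a ∈ Submodule.span K (quotientBaseChange K J '' S) := by
  induction ha using Submodule.span_induction with
  | mem x hx => exact Submodule.subset_span ⟨x, hx, rfl⟩
  | zero => simp
  | add x y _ _ hx hy => rw [_root_.map_add]; exact add_mem hx hy
  | smul c x _ hx => rw [quotientBaseChange_smul]; exact Submodule.smul_mem _ _ hx

lemma mk_mem_span_quotientBaseChange {J : Ideal (MvPolynomial (Fin n) K')}
    {S : Set (MvPolynomial (Fin n) K' ⧸ J)} {f : MvPolynomial (Fin n) K}
    (h : ∀ m ∈ f.support, Ideal.Quotient.mk J (monomial m 1) ∈ Submodule.span K' S) :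
    Ideal.Quotient.mk (extendIdeal K J) f ∈ Submodule.span K (quotientBaseChange K J '' S) := by
  rw [f.as_sum, map_sum]
  refine sum_mem fun m hm => ?_
  have : (monomial m (coeff m f) : MvPolynomial (Fin n) K) =
      coeff m f • map (algebraMap K' K) (monomial m 1) := by
    simp [smul_monomial]
  rw [this, ← Ideal.Quotient.mkₐ_eq_mk K, map_smul, Ideal.Quotient.mkₐ_eq_mk,
    ← quotientBaseChange_mk]
  exact Submodule.smul_mem _ _ (quotientBaseChange_mem_span (h m hm))

/-- The images of a spanning set of the degree `i` part of `K'[x₁, …, xₙ] / J` span the degree `i`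
part of `K[x₁, …, xₙ] / J R` over `K`. -/
lemma quotientGrading_extendIdeal_le {J : Ideal (MvPolynomial (Fin n) K')} {i : ℕ}
    {S : Set (MvPolynomial (Fin n) K' ⧸ J)} (hS : quotientGrading J i ≤ Submodule.span K' S) :
    quotientGrading (extendIdeal K J) i ≤ Submodule.span K (quotientBaseChange K J '' S) := by
  intro a ha
  obtain ⟨f, hf, rfl⟩ := mem_quotientGrading_iff.1 ha
  refine mk_mem_span_quotientBaseChange fun m hm => hS (mk_mem_quotientGrading ?_)
  refine isHomogeneous_monomial _ ?_
  rw [Finsupp.degree_eq_weight_one]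
  exact hf (mem_support_iff.1 hm)

lemma IsArtinianGraded.extendIdeal {J : Ideal (MvPolynomial (Fin n) K')}
    (h : IsArtinianGraded J) : IsArtinianGraded (extendIdeal K J) := by
  have := h.moduleFinite
  obtain ⟨S, hS⟩ := Module.Finite.fg_top (R := K') (M := MvPolynomial (Fin n) K' ⧸ J)
  have : Module.Finite K (MvPolynomial (Fin n) K ⧸ _root_.extendIdeal K J) := by
    classical
    refine ⟨S.image (quotientBaseChange K J), eq_top_iff.2 fun a _ => ?_⟩
    obtain ⟨f, rfl⟩ := Ideal.Quotient.mk_surjective a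
    rw [Finset.coe_image]
    exact mk_mem_span_quotientBaseChange fun m _ => hS ▸ Submodule.mem_top
  exact ⟨isHomogeneous_extendIdeal h.1, .of_finite K _⟩

/-- Every linear functional on `K'[x₁, …, xₙ] / J` extends to `K[x₁, …, xₙ] / J R`. -/
lemma exists_functional_extendIdeal {J : Ideal (MvPolynomial (Fin n) K')}
    (μ : (MvPolynomial (Fin n) K' ⧸ J) →ₗ[K'] K') :
    ∃ ν : (MvPolynomial (Fin n) K ⧸ extendIdeal K J) →ₗ[K] K,
      ∀ a, ν (quotientBaseChange K J a) = algebraMap K' K (μ a) := by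
  let ν₀ : MvPolynomial (Fin n) K →ₗ[K] K := (basisMonomials (Fin n) K).constr K
    fun m => algebraMap K' K (μ (Ideal.Quotient.mk J (monomial m 1)))
  have hν₀ (g : MvPolynomial (Fin n) K') :
      ν₀ (map (algebraMap K' K) g) = algebraMap K' K (μ (Ideal.Quotient.mk J g)) := by
    induction g using MvPolynomial.induction_on' with
    | monomial m c =>
      have h1 : (monomial m (algebraMap K' K c) : MvPolynomial (Fin n) K) =
        algebraMap K' K c • basisMonomials (Fin n) K m := by
        rw [coe_basisMonomials, smul_monomial, smul_eq_mul, mul_one]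
      have h2 : (monomial m c : MvPolynomial (Fin n) K') = c • monomial m 1 := by
        rw [smul_monomial, smul_eq_mul, mul_one]
      rw [map_monomial, h1, map_smul, Module.Basis.constr_basis, h2,
        ← Ideal.Quotient.mkₐ_eq_mk K', map_smul, map_smul]
      simp
    | add p q hp hq => rw [_root_.map_add, _root_.map_add, hp, hq, _root_.map_add, _root_.map_add,
        _root_.map_add]
  have hker (f) (hf : f ∈ (extendIdeal K J).restrictScalars K) : f ∈ LinearMap.ker ν₀ := by
    obtain ⟨r, a, g, hg, rfl⟩ := exists_sum_mul_map_of_mem_extendIdeal hf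
    refine sum_mem fun k _ => ?_
    generalize a k = p
    induction p using MvPolynomial.induction_on' with
    | monomial m c =>
      have : (monomial m c : MvPolynomial (Fin n) K) * map (algebraMap K' K) (g k) =
          c • map (algebraMap K' K) (monomial m 1 * g k) := by
        rw [_root_.map_mul, map_monomial, map_one, ← smul_mul_assoc, smul_monomial, smul_eq_mul,
          mul_one]
      rw [LinearMap.mem_ker, this, map_smul, hν₀,
        Ideal.Quotient.eq_zero_iff_mem.2 (J.mul_mem_left _ (hg k))]
      simp
    | add p q hp hq => rw [add_mul]; exact add_mem hp hq
  refine ⟨((extendIdeal K J).restrictScalars K).liftQ ν₀ hker, fun a => ?_⟩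
  obtain ⟨g, rfl⟩ := Ideal.Quotient.mk_surjective a
  exact hν₀ g

end BaseChange

/-! ### Strong Lefschetz elements -/

section Lefschetz

variable {K' K : Type*} [Field K'] [Field K] [Algebra K' K] {n : ℕ}

lemma mk_linearForm_mul (I : Ideal (MvPolynomial (Fin n) K)) (c : Fin n → K)
    (a : MvPolynomial (Fin n) K ⧸ I) :
    Ideal.Quotient.mk I (linearForm c) * a = ∑ j, c j • (Ideal.Quotient.mk I (X j) * a) := by
  rw [linearForm, map_sum, Finset.sum_mul]
  refine Finset.sum_congr rfl fun j _ => ?_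
  rw [← smul_eq_C_mul, ← Ideal.Quotient.mkₐ_eq_mk K, map_smul, smul_mul_assoc]

/-- The values of `t ↦ μ ((t₁ x₁ + ⋯ + tₙ xₙ) ^ d * v)` at `t = c`, and of its base change to `K` at
`t = η`, are values of one and the same polynomial `P` over `K'`. -/
lemma exists_polynomial_matrix_entry {J : Ideal (MvPolynomial (Fin n) K')} (c : Fin n → K')
    (η : Fin n → K) (μ : (MvPolynomial (Fin n) K' ⧸ J) →ₗ[K'] K')
    (ν : (MvPolynomial (Fin n) K ⧸ extendIdeal K J) →ₗ[K] K)
    (hν : ∀ a, ν (quotientBaseChange K J a) = algebraMap K' K (μ a)) (d : ℕ)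
    (v : MvPolynomial (Fin n) K' ⧸ J) :
    ∃ P : MvPolynomial (Fin n) K',
      aeval c P = μ (Ideal.Quotient.mk J (linearForm c) ^ d * v) ∧
      aeval η P = ν (Ideal.Quotient.mk _ (linearForm η) ^ d * quotientBaseChange K J v) := by
  induction d generalizing v with
  | zero => exact ⟨C (μ v), by simp, by simp [hν]⟩
  | succ d ih =>
    choose P hc hη using fun j => ih (Ideal.Quotient.mk J (X j) * v)
    refine ⟨∑ j, X j * P j, ?_, ?_⟩
    · rw [pow_succ, mul_assoc, mk_linearForm_mul, Finset.mul_sum]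
      simp only [map_sum, _root_.map_mul, aeval_X, hc, mul_smul_comm, map_smul, smul_eq_mul]
    · rw [pow_succ, mul_assoc, mk_linearForm_mul, Finset.mul_sum]
      simp only [map_sum, _root_.map_mul, aeval_X, hη, mul_smul_comm, map_smul, smul_eq_mul,
        quotientBaseChange_mk, map_X]

/-- If a matrix of functionals applied to `d`-th powers of linear forms is the identity at the
coefficients `c`, it is invertible at `η`, as its determinant is a polynomial nonvanishing at `c`. -/
lemma isUnit_det_of_specialization {J : Ideal (MvPolynomial (Fin n) K')} {c : Fin n → K'}
    {η : Fin n → K} (h : ∀ P : MvPolynomial (Fin n) K', aeval c P ≠ 0 → aeval η P ≠ 0)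
    {ι : Type*} [Fintype ι] [DecidableEq ι] {d : ℕ} (v : ι → MvPolynomial (Fin n) K' ⧸ J)
    (μ : ι → (MvPolynomial (Fin n) K' ⧸ J) →ₗ[K'] K')
    (ν : ι → (MvPolynomial (Fin n) K ⧸ extendIdeal K J) →ₗ[K] K)
    (hν : ∀ k a, ν k (quotientBaseChange K J a) = algebraMap K' K (μ k a))
    (hμ : ∀ k j, μ k (Ideal.Quotient.mk J (linearForm c) ^ d * v j) = if k = j then 1 else 0) :
    IsUnit (Matrix.of fun k j =>
      ν k (Ideal.Quotient.mk _ (linearForm η) ^ d * quotientBaseChange K J (v j))).det := by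
  choose P hc hη using fun k j => exists_polynomial_matrix_entry c η (μ k) (ν k) (hν k) d (v j)
  have hPc : aeval c (Matrix.of P).det = 1 := by
    rw [← AlgHom.coe_toRingHom, RingHom.map_det, ← Matrix.det_one (n := ι)]
    congr 1
    ext k j
    rw [Matrix.one_apply, ← hμ k j, ← hc k j]
    rfl
  have hPη := h (Matrix.of P).det (by simp [hPc])
  rw [← AlgHom.coe_toRingHom, RingHom.map_det] at hPη
  convert! isUnit_iff_ne_zero.2 hPη using 3
  ext k j
  exact (hη k j).symm

/-- If `η` is at least as generic over `K'` as `c`, the SL property passes from `c₁ x₁ + ⋯ + cₙ xₙ` on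
`K'[x₁, …, xₙ] / J` to `η₁ x₁ + ⋯ + ηₙ xₙ` on `K[x₁, …, xₙ] / J R`. The hypothesis on `η` covers both
algebraically independent `η` and the image of `c` in `K`. -/
theorem IsSLElement.of_specialization {J : Ideal (MvPolynomial (Fin n) K')}
    [Module.Finite K' (MvPolynomial (Fin n) K' ⧸ J)] {c : Fin n → K'} {η : Fin n → K}
    (h : ∀ P : MvPolynomial (Fin n) K', aeval c P ≠ 0 → aeval η P ≠ 0)
    (hc : IsSLElement (quotientGrading J) (Ideal.Quotient.mk J (linearForm c))) :
    IsSLElement (quotientGrading (extendIdeal K J))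
      (Ideal.Quotient.mk (extendIdeal K J) (linearForm η)) := by
  classical
  refine ⟨mk_mem_quotientGrading (isHomogeneous_linearForm η), fun d i => ?_⟩
  set z := Ideal.Quotient.mk J (linearForm c) with hz
  set w := Ideal.Quotient.mk (extendIdeal K J) (linearForm η) with hw
  let ψ := quotientBaseChange K J
  have hspan (i : ℕ) : quotientGrading (extendIdeal K J) i ≤ Submodule.span K (Set.range
      fun j => ψ (Module.finBasis K' (quotientGrading J i) j)) := by
    have := quotientGrading_extendIdeal_le (K := K) (J := J) (i := i)
      (S := Set.range fun j => (Module.finBasis K' (quotientGrading J i) j : _ ⧸ J)) (by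
        intro a ha
        have := (Module.finBasis K' (quotientGrading J i)).mem_span ⟨a, ha⟩
        have := Submodule.mem_map_of_mem (f := (quotientGrading J i).subtype) this
        rwa [Submodule.map_span, ← Set.range_comp] at this)
    rwa [← Set.range_comp] at this
  rcases hc.2 d i with hinj | hsurj
  · left
    let b := Module.finBasis K' (quotientGrading J i)
    let T : quotientGrading J i →ₗ[K'] (MvPolynomial (Fin n) K' ⧸ J) :=
      LinearMap.mulLeft K' (z ^ d) ∘ₗ (quotientGrading J i).subtype
    have hT : LinearMap.ker T = ⊥ := LinearMap.ker_eq_bot.2 fun a a' haa =>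
      Subtype.ext (hinj a.2 a'.2 haa)
    -- The coordinates of a left inverse of `× z ^ d`, applied to `z ^ d * b j`, give the identity
    -- matrix over `K'`.
    obtain ⟨π, hπ⟩ := T.exists_leftInverse_of_injective hT
    choose ν hν using fun k => exists_functional_extendIdeal (K := K) (b.coord k ∘ₗ π)
    have hdet := isUnit_det_of_specialization h (d := d) (fun j => (b j : _ ⧸ J))
      (fun k => b.coord k ∘ₗ π) ν hν fun k j => by
        have : π (z ^ d * b j) = b j := LinearMap.congr_fun hπ (b j)
        simp [← hz, this, Finsupp.single_apply, eq_comm]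
    intro a ha a' ha' haa
    have hsub := sub_mem ha ha'
    obtain ⟨x, hx⟩ := (Submodule.mem_span_range_iff_exists_fun K).1 (hspan i hsub)
    have hzero : w ^ d * (a - a') = 0 := by rw [mul_sub]; exact sub_eq_zero.2 haa
    have hx0 : x = 0 := by
      refine Matrix.eq_zero_of_mulVec_eq_zero hdet.ne_zero ?_
      ext k
      have := congrArg (ν k) hzero
      rw [← hx, Finset.mul_sum, map_sum, map_zero] at this
      rw [Pi.zero_apply, ← this, Matrix.mulVec, dotProduct]
      refine Finset.sum_congr rfl fun j _ => ?_
      rw [mul_smul_comm, map_smul, smul_eq_mul, mul_comm]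
      rfl
    rw [hx0] at hx
    exact sub_eq_zero.1 (by simpa using hx.symm)
  · right
    let b := Module.finBasis K' (quotientGrading J (i + d))
    obtain ⟨π, hπ⟩ := (quotientGrading J (i + d)).subtype.exists_leftInverse_of_injective
      (Submodule.ker_subtype _)
    have hπb (j) : π (b j) = b j := LinearMap.congr_fun hπ (b j)
    -- The coordinates of a projection onto the target, applied to `z ^ d * v j` with `v j` a preimage
    -- of `b j`, give the identity matrix over `K'`.
    choose v hv hvb using fun j => hsurj (b j).2
    choose ν hν using fun k => exists_functional_extendIdeal (K := K) (b.coord k ∘ₗ π)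
    have hdet := isUnit_det_of_specialization h (d := d) v
      (fun k => b.coord k ∘ₗ π) ν hν fun k j => by
        have : z ^ d * v j = b j := hvb j
        simp [← hz, this, hπb, Finsupp.single_apply, eq_comm]
    -- The extended functionals are coordinates on the target over `K`.
    have hexp (a : MvPolynomial (Fin n) K ⧸ extendIdeal K J)
        (ha : a ∈ quotientGrading (extendIdeal K J) (i + d)) :
        ∑ k, ν k a • ψ (b k) = a := by
      obtain ⟨x, rfl⟩ := (Submodule.mem_span_range_iff_exists_fun K).1 (hspan (i + d) ha)
      refine Finset.sum_congr rfl fun k _ => ?_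
      have hxk : ν k (∑ j, x j • ψ (b j)) = x k := by
        have hδ (j) : ν k (ψ (b j)) = if j = k then 1 else 0 := by
          rw [hν]
          simp [hπb, Finsupp.single_apply]
        rw [map_sum, Finset.sum_eq_single k] <;> simp +contextual [hδ]
      rw [hxk]
    intro a ha
    obtain ⟨x, hx⟩ : ∃ x, (Matrix.of fun k j => ν k (w ^ d * ψ (v j))).mulVec x = fun k => ν k a :=
      Matrix.mulVec_surjective_iff_isUnit.2 ((Matrix.isUnit_iff_isUnit_det _).2 hdet) _
    have hmem (j) : ψ (v j) ∈ quotientGrading (extendIdeal K J) i :=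
      quotientBaseChange_mem_quotientGrading (hv j)
    have hmul (u) (hu : u ∈ quotientGrading (extendIdeal K J) i) :
        w ^ d * u ∈ quotientGrading (extendIdeal K J) (i + d) := by
      obtain ⟨f, hf, rfl⟩ := mem_quotientGrading_iff.1 hu
      rw [hw, ← map_pow, ← _root_.map_mul]
      refine mk_mem_quotientGrading ?_
      simpa [add_comm] using ((isHomogeneous_linearForm η).pow d).mul hf
    have hsum : ∑ j, x j • ψ (v j) ∈ quotientGrading (extendIdeal K J) i :=
      sum_mem fun j _ => Submodule.smul_mem _ _ (hmem j)
    refine ⟨_, hsum, ?_⟩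
    change w ^ d * _ = a
    rw [← hexp _ (hmul _ hsum), ← hexp a ha]
    refine Finset.sum_congr rfl fun k _ => ?_
    rw [← congrFun hx k, Finset.mul_sum, map_sum]
    congr 1
    refine Finset.sum_congr rfl fun j _ => ?_
    rw [mul_smul_comm, map_smul, smul_eq_mul, mul_comm]
    rfl

/-- Multiplication by `L ^ d` on `K[x₁, …, xₙ] / (I : L ^ e)` is, via multiplication by `L ^ e`, the
multiplication by `L ^ d` on `L ^ e · K[x₁, …, xₙ] / I`; it inherits injectivity or surjectivity from
multiplication by `L ^ (e + d)` on `K[x₁, …, xₙ] / I`. -/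
theorem IsSLElement.colon_pow {I : Ideal (MvPolynomial (Fin n) K)} {c : Fin n → K}
    (hc : IsSLElement (quotientGrading I) (Ideal.Quotient.mk I (linearForm c))) (e : ℕ) :
    IsSLElement (quotientGrading (I.colon {linearForm c ^ e}))
      (Ideal.Quotient.mk (I.colon {linearForm c ^ e}) (linearForm c)) := by
  have hL := isHomogeneous_linearForm c
  set L := linearForm c
  have hmk (f g : MvPolynomial (Fin n) K) :
      Ideal.Quotient.mk (I.colon {L ^ e}) f = Ideal.Quotient.mk (I.colon {L ^ e}) g ↔
        Ideal.Quotient.mk I (L ^ e * f) = Ideal.Quotient.mk I (L ^ e * g) := by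
    rw [Ideal.Quotient.mk_eq_mk_iff_sub_mem, Ideal.Quotient.mk_eq_mk_iff_sub_mem,
      Submodule.mem_colon_singleton, smul_eq_mul, sub_mul, mul_comm f, mul_comm g]
  refine ⟨mk_mem_quotientGrading hL, fun d i => ?_⟩
  rcases hc.2 (e + d) i with h | h
  · left
    rintro _ ⟨f, hf, rfl⟩ _ ⟨g, hg, rfl⟩ hfg
    have hfg : Ideal.Quotient.mk (I.colon {L ^ e}) (L ^ d * f) =
      Ideal.Quotient.mk (I.colon {L ^ e}) (L ^ d * g) := by simpa using hfg
    rw [hmk, ← mul_assoc, ← mul_assoc, ← pow_add] at hfg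
    have := h (mk_mem_quotientGrading hf) (mk_mem_quotientGrading hg) (by simpa using hfg)
    exact (hmk f g).2 (by rw [_root_.map_mul, _root_.map_mul, this])
  · right
    rintro _ ⟨g, hg, rfl⟩
    have hLg : (L ^ e * g).IsHomogeneous (i + (e + d)) := by
      simpa [add_left_comm, add_comm, add_assoc] using (hL.pow e).mul hg
    obtain ⟨_, ⟨f, hf, rfl⟩, hfg⟩ := h (mk_mem_quotientGrading (I := I) hLg)
    refine ⟨_, mk_mem_quotientGrading hf, ?_⟩
    have : Ideal.Quotient.mk (I.colon {L ^ e}) (L ^ d * f) =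
        Ideal.Quotient.mk (I.colon {L ^ e}) g := by
      rw [hmk, ← mul_assoc, ← pow_add]
      simpa using hfg
    simpa using this

lemma HasSLP.exists_linearForm {I : Ideal (MvPolynomial (Fin n) K)} (h : HasSLP I) :
    ∃ c, IsSLElement (quotientGrading I) (Ideal.Quotient.mk I (linearForm c)) := by
  obtain ⟨z, hz⟩ := h
  obtain ⟨f, hf, rfl⟩ := mem_quotientGrading_iff.1 hz.1
  obtain ⟨c, rfl⟩ := exists_eq_linearForm hf
  exact ⟨c, hz⟩

theorem HasSLP.extendIdeal {J : Ideal (MvPolynomial (Fin n) K')} (hJ : IsArtinianGraded J)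
    (h : HasSLP J) : HasSLP (extendIdeal K J) := by
  have := hJ.moduleFinite
  obtain ⟨c, hc⟩ := h.exists_linearForm
  exact ⟨_, hc.of_specialization (η := algebraMap K' K ∘ c) fun P hP => by
    rwa [aeval_algebraMap_apply, Ne, map_eq_zero_iff _ (algebraMap K' K).injective]⟩

/-- A linear form with algebraically independent coefficients is an SL element. -/
theorem HasSLP.isSLElement_linearForm {J : Ideal (MvPolynomial (Fin n) K')}
    (hJ : IsArtinianGraded J) (h : HasSLP J) {η : Fin n → K} (hη : AlgebraicIndependent K' η) :
    IsSLElement (quotientGrading (_root_.extendIdeal K J))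
      (Ideal.Quotient.mk (_root_.extendIdeal K J) (linearForm η)) := by
  have := hJ.moduleFinite
  obtain ⟨c, hc⟩ := h.exists_linearForm
  refine hc.of_specialization fun P hP hPη => hP ?_
  rw [hη.eq_zero_of_aeval_eq_zero P hPη, map_zero]

end Lefschetz

/-! ### Colon ideals by products of generic linear forms -/

open scoped IntermediateField.algebraAdjoinAdjoin in
/-- If the joint family `(y, x)` is algebraically independent over `F`, then `y` is algebraically
independent over the field `F(x)`. -/
lemma AlgebraicIndependent.adjoin_of_sumElim {F E : Type*} [Field F] [Field E] [Algebra F E]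
    {ι κ : Type*} {x : ι → E} {y : κ → E} (h : AlgebraicIndependent F (Sum.elim y x)) :
    AlgebraicIndependent (IntermediateField.adjoin F (Set.range x)) y := by
  have := (AlgebraicIndependent.sumElim_iff.1 h).2
  have : Algebra.IsAlgebraic (Algebra.adjoin F (Set.range x))
    (IntermediateField.adjoin F (Set.range x)) := 
    (IsFractionRing.comap_isAlgebraic_iff (K := IntermediateField.adjoin F (Set.range x))).2
      inferInstance
  exact AlgebraicIndependent.extendScalars _ ‹_›

lemma Ideal.colon_colon_singleton {R : Type*} [CommRing R] (I : Ideal R) (a b : R) :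
    (I.colon {a}).colon {b} = I.colon {a * b} := by
  ext f
  simp only [Submodule.mem_colon_singleton, smul_eq_mul]
  rw [mul_assoc, mul_comm b a]

universe u

/-- Colon ideals by products of powers of generic linear forms are Artinian graded with the SLP. The
base field `K'` varies in the induction on `m`, where it is replaced by subfields of `K`; this is why
`K'` and `K` share a universe. -/
theorem colon_prod_linearForm {K : Type u} [Field K] {n m : ℕ} :
    ∀ {K' : Type u} [Field K'] [Algebra K' K] {J : Ideal (MvPolynomial (Fin n) K')},
      IsArtinianGraded J → HasSLP J → ∀ ξ : Fin m → Fin n → K,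
      AlgebraicIndependent K' (fun p : Fin m × Fin n => ξ p.1 p.2) → ∀ d : Fin m → ℕ,
        IsArtinianGraded ((extendIdeal K J).colon {∏ i, linearForm (ξ i) ^ d i}) ∧
        HasSLP ((extendIdeal K J).colon {∏ i, linearForm (ξ i) ^ d i}) := by
  induction m with
  | zero =>
    intro K' _ _ J hJ h ξ _ d
    have : (extendIdeal K J).colon {∏ i, linearForm (ξ i) ^ d i} = extendIdeal K J := by
      ext; simp
    rw [this]
    exact ⟨hJ.extendIdeal, h.extendIdeal hJ⟩
  | succ m ih =>
    intro K' _ _ J hJ h ξ hξ d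
    let E := IntermediateField.adjoin K' (Set.range (ξ 0))
    -- The coefficients of the first linear form, viewed in `E`.
    let ζ : Fin n → E := fun j => ⟨ξ 0 j, IntermediateField.subset_adjoin _ _ ⟨j, rfl⟩⟩
    have hζ : AlgebraicIndependent K' ζ := by
      have h0 : AlgebraicIndependent K' (E.val ∘ ζ) :=
        hξ.comp (fun j => ((0 : Fin (m + 1)), j)) fun _ _ h => (Prod.ext_iff.1 h).2
      exact h0.of_comp E.val
    have hξ' : AlgebraicIndependent E (fun p : Fin m × Fin n => ξ p.1.succ p.2) := by
      refine AlgebraicIndependent.adjoin_of_sumElim ?_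
      have := hξ.comp (Sum.elim (fun p : Fin m × Fin n => (p.1.succ, p.2)) fun j => (0, j)) (by
        rintro (⟨i, j⟩ | j) (⟨i', j'⟩ | j') <;> simp [Fin.succ_ne_zero, (Fin.succ_ne_zero _).symm])
      convert! this using 1
      ext (_ | _) <;> rfl
    have hSL := (h.isSLElement_linearForm hJ hζ).colon_pow (d 0)
    have := ih ((hJ.extendIdeal (K := E)).colon ((isHomogeneous_linearForm ζ).pow (d 0)))
      ⟨_, hSL⟩ (fun i => ξ i.succ) hξ' (fun i => d i.succ)
    rw [extendIdeal_colon, extendIdeal_extendIdeal, map_pow, map_linearForm,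
      Ideal.colon_colon_singleton] at this
    rw [Fin.prod_univ_succ]
    exact this

theorem lemma4p5 {K' K : Type*} [Field K'] [Field K] [CharZero K] [Algebra K' K] (n : ℕ)
    (J : Ideal (MvPolynomial (Fin n) K')) (hJ : IsArtinianGraded J) (hSLP : HasSLP J) :
    (∀ η : Fin n → K, AlgebraicIndependent K' η →
      IsArtinianGraded (extendIdeal K J) ∧
      IsSLElement (quotientGrading (extendIdeal K J))
        (Ideal.Quotient.mk (extendIdeal K J) (linearForm η))) ∧
    (∀ (m : ℕ) (ξ : Fin m → Fin n → K),
      AlgebraicIndependent K' (fun p : Fin m × Fin n => ξ p.1 p.2) →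
      ∀ d : Fin m → ℕ, (∀ i, 0 < d i) →
        IsArtinianGraded ((extendIdeal K J).colon {∏ i, linearForm (ξ i) ^ d i}) ∧
        HasSLP ((extendIdeal K J).colon {∏ i, linearForm (ξ i) ^ d i})) := by
  refine ⟨fun η hη => ⟨hJ.extendIdeal, hSLP.isSLElement_linearForm hJ hη⟩, fun m ξ hξ d _ => ?_⟩
  -- Passing to the copy of `K'` inside `K` puts both fields in one universe.
  have hξ' : AlgebraicIndependent (⊥ : IntermediateField K' K)
      (fun p : Fin m × Fin n => ξ p.1 p.2) := by
    have : Algebra.IsAlgebraic K' (⊥ : IntermediateField K' K) := inferInstance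
    exact hξ.extendScalars _
  have := colon_prod_linearForm (hJ.extendIdeal (K := (⊥ : IntermediateField K' K)))
    (hSLP.extendIdeal hJ) ξ hξ' d
  rwa [extendIdeal_extendIdeal] at this
end
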